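/- For a finite graph $G$ with adjacency matrix $A$ and eigenvalues $\lambda_1\ge\dots\ge\lambda_N$ (listed with multiplicity, $N=|V(G)|$), let the *inertia bound* be $\min\{|\{i:\lambda_i\ge 0\}|,\ |\{i:\lambda_i\le 0\}|\}$ and the *ratio bound* be $N/(1-\lambda_1/\lambda_N)$. Let $\alpha_t(G)$ be the maximum number of vertices of $G$ that are mutually at distance greater than $t$, so that $\alpha_1=\alpha$ is the independence number. A *$t$-sign polynomial* of $G$ is a real polynomial $s$ of degree at most $t$ with $\operatorname{tr}s(A)=\sum_i s(\lambda_i)=0$ which, among all such polynomials, minimizes $|\{i:s(\lambda_i)\ge 0\}|$; this number is the inertia-type bound given by $s$. A *$t$-minor polynomial* of $G$ is a real polynomial $f$ of degree at most $t$ with $f(\lambda_1)=1$ and $f(\lambda_i)\ge 0$ for every eigenvalue $\lambda_i\ne\lambda_1$ which, among all such polynomials, minimizes $\operatorname{tr}f(A)=\sum_i f(\lambda_i)$; this number is the ratio-type bound given by $f$. The polynomials $s$ and $f$ are *linearly related* if $s=c\left(\frac{N}{\operatorname{tr}f(A)}\,f-1\right)$ for some real $c\ne 0$. A connected regular graph $G$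 in which, for each $l\le t$, the number of closed walks of length $l$ rooted at a vertex does not depend on the vertex is a *$t$-Cvetković–Hoffman graph* if it has $t$-sign polynomials and $t$-minor polynomials, and every $t$-sign polynomial $s$ and every $t$-minor polynomial $f$ are linearly related and give the same bound. It is *tight* if this common bound equals $\alpha_t(G)$. The *Kneser graph* $K(n,k)$ has as vertices the $k$-subsets of $\{1,\dots,n\}$, two distinct vertices being adjacent if and only if they are disjoint. **Corollary.** Let $k\ge 1$ and $n>2k$. Then $K(n,k)$ is a tight $1$-Cvetković–Hoffman graph. Moreover, its inertia bound, its ratio bound and its independence number are all equal to $\binom{n-1}{k-1}$. -/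

import Mathlib

namespace SimpleGraph

/-- The Kneser graph `K(n,k)`: its vertices are the `k`-subsets of an `n`-set, and two (distinct)
vertices are adjacent when they are disjoint. The requirement of distinctness only matters for
`k = 0`. -/
def kneserGraph (n k : ℕ) : SimpleGraph {s : Finset (Fin n) // s.card = k} where
  Adj s t := s ≠ t ∧ Disjoint s.1 t.1
  symm := ⟨fun _ _ h => ⟨h.1.symm, h.2.symm⟩⟩
  loopless := ⟨fun _ h => h.1 rfl⟩

instance (n k : ℕ) : DecidableRel (kneserGraph n k).Adj :=
  fun s t => inferInstanceAs (Decidable (s ≠ t ∧ Disjoint s.1 t.1))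

/-- The `t`-independence number: the maximum number of vertices that are mutually at distance
greater than `t`. -/
noncomputable def tIndepNum {V : Type*} (G : SimpleGraph V) (t : ℕ) : ℕ :=
  sSup {m | ∃ s : Finset V, s.card = m ∧ (s : Set V).Pairwise fun u v => (t : ℕ∞) < G.edist u v}

section Spectrum

variable {V : Type*} [Fintype V] [DecidableEq V] (G : SimpleGraph V) [DecidableRel G.Adj]

/-- The eigenvalues of the adjacency matrix, listed with their multiplicities (the list is
indexed by the vertex set). -/
noncomputable def adjEigenvalue : V → ℝ := (G.isHermitian_adjMatrix (R := ℝ)).eigenvalues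

/-- The largest eigenvalue of the adjacency matrix. -/
noncomputable def maxAdjEigenvalue : ℝ := ⨆ i, G.adjEigenvalue i

/-- The least eigenvalue of the adjacency matrix. -/
noncomputable def minAdjEigenvalue : ℝ := ⨅ i, G.adjEigenvalue i

/-- The inertia bound `min {|{i : λ_i ≥ 0}|, |{i : λ_i ≤ 0}|}`. -/
noncomputable def inertiaBound : ℕ :=
  min (Finset.univ.filter fun i => 0 ≤ G.adjEigenvalue i).card
    (Finset.univ.filter fun i => G.adjEigenvalue i ≤ 0).card

/-- The ratio bound `|V| / (1 - λ_max / λ_min)`. -/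
noncomputable def ratioBound : ℝ :=
  (Fintype.card V : ℝ) / (1 - G.maxAdjEigenvalue / G.minAdjEigenvalue)

/-- The sum of `p(λ)` over all eigenvalues, with multiplicity; this is the trace of `p(A)`. -/
noncomputable def polyTrace (p : Polynomial ℝ) : ℝ := ∑ i, p.eval (G.adjEigenvalue i)

/-- The number of eigenvalues `λ`, with multiplicity, such that `s(λ) ≥ 0`. This is the
inertia-type bound given by a polynomial `s` with `tr s(A) = 0`. -/
noncomputable def signCount (s : Polynomial ℝ) : ℕ :=
  (Finset.univ.filter fun i => 0 ≤ s.eval (G.adjEigenvalue i)).card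

/-- Feasibility for the problem that defines the `t`-sign polynomials: degree at most `t` and
`tr s(A) = 0`. -/
def IsSignFeasible (t : ℕ) (s : Polynomial ℝ) : Prop :=
  s.natDegree ≤ t ∧ G.polyTrace s = 0

/-- A `t`-sign polynomial: among the polynomials of degree at most `t` with `tr s(A) = 0`, it
minimizes the number of eigenvalues at which it is non-negative. -/
def IsSignPoly (t : ℕ) (s : Polynomial ℝ) : Prop :=
  G.IsSignFeasible t s ∧ ∀ p, G.IsSignFeasible t p → G.signCount s ≤ G.signCount p

/-- Feasibility for the linear programme that defines the `t`-minor polynomials: degree at most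
`t`, value `1` at the largest eigenvalue, and non-negative values at all the others. -/
def IsMinorFeasible (t : ℕ) (f : Polynomial ℝ) : Prop :=
  f.natDegree ≤ t ∧ f.eval G.maxAdjEigenvalue = 1 ∧
    ∀ i, G.adjEigenvalue i ≠ G.maxAdjEigenvalue → 0 ≤ f.eval (G.adjEigenvalue i)

/-- A `t`-minor polynomial: a feasible polynomial that minimizes `tr f(A)`. This minimum is the
ratio-type bound that it gives. -/
def IsMinorPoly (t : ℕ) (f : Polynomial ℝ) : Prop :=
  G.IsMinorFeasible t f ∧ ∀ p, G.IsMinorFeasible t p → G.polyTrace f ≤ G.polyTrace p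

/-- `s` and `f` are linearly related: up to a non-zero scalar factor (positive or negative),
`s = (|V| / tr f(A)) f - 1`. -/
def LinearlyRelated (s f : Polynomial ℝ) : Prop :=
  ∃ c : ℝ, c ≠ 0 ∧
    s = Polynomial.C c * (Polynomial.C ((Fintype.card V : ℝ) / G.polyTrace f) * f - 1)

/-- The number of closed walks of length `l ≤ t` rooted at a vertex depends only on `l`. -/
def IsPartiallyWalkRegular (t : ℕ) : Prop :=
  ∀ l ≤ t, ∀ u v : V, ((G.adjMatrix ℕ) ^ l) u u = ((G.adjMatrix ℕ) ^ l) v v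

/-- A `t`-Cvetković–Hoffman graph: a connected regular `t`-partially walk-regular graph whose
`t`-sign polynomials and `t`-minor polynomials exist, are linearly related, and give the same
bound on the `t`-independence number. -/
structure IsCvetkovicHoffman (t : ℕ) : Prop where
  connected : G.Connected
  regular : ∃ r, G.IsRegularOfDegree r
  walkRegular : G.IsPartiallyWalkRegular t
  exists_sign : ∃ s, G.IsSignPoly t s
  exists_minor : ∃ f, G.IsMinorPoly t f
  related : ∀ s f, G.IsSignPoly t s → G.IsMinorPoly t f → G.LinearlyRelated s f
  bounds_eq : ∀ s f, G.IsSignPoly t s → G.IsMinorPoly t f → (G.signCount s : ℝ) = G.polyTrace f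

/-- A tight `t`-Cvetković–Hoffman graph: the common value of the two bounds is the
`t`-independence number. -/
structure IsTightCvetkovicHoffman (t : ℕ) : Prop extends G.IsCvetkovicHoffman t where
  sign_tight : ∀ s, G.IsSignPoly t s → G.signCount s = G.tIndepNum t
  minor_tight : ∀ f, G.IsMinorPoly t f → G.polyTrace f = (G.tIndepNum t : ℝ)

end Spectrum

end SimpleGraph

/-! Since `tr A = 0`, the polynomials of degree at most `1` with trace zero are the multiples of
`X`, and the linear programme behind the `1`-minor polynomials has as its only solution the linear
polynomial that vanishes at the least eigenvalue. These are linearly related in every graph with an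
edge, and they give the inertia bound and the ratio bound, so a connected regular graph in which
both bounds equal `α` is a tight `1`-Cvetković–Hoffman graph.

Let `A` be the adjacency matrix of `K(n, k)`. If `A y = μ y` and `J` is minimal among the sets with
`∑_{S ⊇ J} y_S ≠ 0`, then inclusion–exclusion gives `μ = (-1)^|J| C(n - k - |J|, k - |J|)`. So `A`
is nonsingular, and its least eigenvalue is the one with `|J| = 1`, which yields the ratio bound.

The star of a point `a` shows `α ≥ C(n - 1, k - 1)`. Conversely, consider the space of those `x`
for which `A x` vanishes on the star; its codimension is at most `C(n - 1, k - 1)`. The part `y` of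
such an `x` off the star satisfies `A y = (-1)^k y`, again by inclusion–exclusion, while the part
on the star does not contribute to `xᵀ A x`. So the quadratic form of `A` has the constant sign
`(-1)^k` on this space, and since `A` is nonsingular the eigenvalues of the opposite sign bound the
inertia bound by `C(n - 1, k - 1)`. -/

section Inertia

open Matrix QuadraticMap QuadraticForm

variable {V : Type*} [Fintype V] [DecidableEq V] {A : Matrix V V ℝ}

lemma toQuadraticForm'_eq_dotProduct_mulVec (A : Matrix V V ℝ) (x : V → ℝ) :
    A.toQuadraticForm' x = x ⬝ᵥ A *ᵥ x := by
  simp [toQuadraticForm', toLinearMap₂'_apply']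

lemma equivalent_weightedSumSquares_eigenvalues (hA : A.IsHermitian) :
    A.toQuadraticForm'.Equivalent (weightedSumSquares ℝ hA.eigenvalues) := by
  let v := hA.eigenvectorBasis.toBasis.map (WithLp.linearEquiv 2 ℝ (V → ℝ))
  have hv (i j : V) : v i ⬝ᵥ A *ᵥ v j = hA.eigenvalues j * if i = j then 1 else 0 := by
    have h := orthonormal_iff_ite.1 hA.eigenvectorBasis.orthonormal j i
    simp only [EuclideanSpace.inner_eq_star_dotProduct, star_trivial] at h
    simp [v, hA.mulVec_eigenvectorBasis, h, eq_comm]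
  have hortho : (associated (R := ℝ) A.toQuadraticForm').IsOrthoᵢ v := fun i j hij => by
    simp [Function.onFun, associated_apply, toQuadraticForm'_eq_dotProduct_mulVec, mulVec_add,
      hv, hij, hij.symm]
  have hdiag (i : V) : A.toQuadraticForm' (v i) = hA.eigenvalues i := by
    rw [toQuadraticForm'_eq_dotProduct_mulVec, hv, if_pos rfl, mul_one]
  have hrepr := basisRepr_eq_of_iIsOrtho _ v hortho
  simp only [hdiag] at hrepr
  exact hrepr ▸ ⟨isometryEquivBasisRepr _ v⟩

lemma finrank_le_card_eigenvalues_nonpos (hA : A.IsHermitian) {W : Submodule ℝ (V → ℝ)}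
    (hW : ∀ x ∈ W, x ⬝ᵥ A *ᵥ x ≤ 0) :
    Module.finrank ℝ W ≤ (Finset.univ.filter fun i => hA.eigenvalues i ≤ 0).card := by
  have h := sigPos_add_finrank_le_of_nonpos (Q := A.toQuadraticForm') (V := W)
    (by simpa only [toQuadraticForm'_eq_dotProduct_mulVec])
  rw [sigPos_of_equiv_weightedSumSquares (equivalent_weightedSumSquares_eigenvalues hA),
    Module.finrank_pi, ← Finset.card_univ, Set.ncard_eq_toFinset_card', Set.toFinset_ofPred,
    ← Finset.card_filter_add_card_filter_not (s := Finset.univ)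
      (fun i => 0 < hA.eigenvalues i)] at h
  simpa only [not_lt] using Nat.le_of_add_le_add_left h

lemma finrank_le_card_eigenvalues_nonneg (hA : A.IsHermitian) {W : Submodule ℝ (V → ℝ)}
    (hW : ∀ x ∈ W, 0 ≤ x ⬝ᵥ A *ᵥ x) :
    Module.finrank ℝ W ≤ (Finset.univ.filter fun i => 0 ≤ hA.eigenvalues i).card := by
  have h := sigPos_add_finrank_le_of_nonpos (Q := -A.toQuadraticForm') (V := W)
    (by simpa [toQuadraticForm'_eq_dotProduct_mulVec])
  rw [sigPos_neg,
    sigNeg_of_equiv_weightedSumSquares (equivalent_weightedSumSquares_eigenvalues hA),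
    Module.finrank_pi, ← Finset.card_univ, Set.ncard_eq_toFinset_card', Set.toFinset_ofPred,
    ← Finset.card_filter_add_card_filter_not (s := Finset.univ)
      (fun i => hA.eigenvalues i < 0)] at h
  simpa only [not_lt] using Nat.le_of_add_le_add_left h

end Inertia

section AdjacencySpectrum

open SimpleGraph Matrix

variable {V : Type*} [Fintype V] [DecidableEq V] (G : SimpleGraph V) [DecidableRel G.Adj]

lemma hasEigenvalue_adjMatrix_iff {μ : ℝ} :
    Module.End.HasEigenvalue (toLin' (G.adjMatrix ℝ)) μ ↔ ∃ i, G.adjEigenvalue i = μ := by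
  rw [Module.End.hasEigenvalue_iff_mem_spectrum, spectrum_toLin',
    (G.isHermitian_adjMatrix (R := ℝ)).spectrum_real_eq_range_eigenvalues]
  rfl

variable {G} in
lemma exists_adjEigenvalue_eq {x : V → ℝ} (hx : x ≠ 0) {μ : ℝ}
    (h : G.adjMatrix ℝ *ᵥ x = μ • x) : ∃ i, G.adjEigenvalue i = μ :=
  (hasEigenvalue_adjMatrix_iff G).1 <| Module.End.hasEigenvalue_of_hasEigenvector
    (Module.End.hasEigenvector_iff.2 ⟨Module.End.mem_eigenspace_iff.2 h, hx⟩)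

lemma adjEigenvalue_le_maxAdjEigenvalue (i : V) : G.adjEigenvalue i ≤ G.maxAdjEigenvalue :=
  le_ciSup (Set.finite_range _).bddAbove i

lemma minAdjEigenvalue_le_adjEigenvalue (i : V) : G.minAdjEigenvalue ≤ G.adjEigenvalue i :=
  ciInf_le (Set.finite_range _).bddBelow i

lemma sum_adjEigenvalue : ∑ i, G.adjEigenvalue i = 0 := by
  have h := (G.isHermitian_adjMatrix (R := ℝ)).trace_eq_sum_eigenvalues
  rw [trace_adjMatrix] at h
  exact h.symm

variable {G} in
lemma exists_adjEigenvalue_ne_zero (hG : G ≠ ⊥) : ∃ i, G.adjEigenvalue i ≠ 0 := by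
  obtain ⟨u, v, huv⟩ := ne_bot_iff_exists_adj.1 hG
  by_contra! h
  have hA := (G.isHermitian_adjMatrix (R := ℝ)).eigenvalues_eq_zero_iff.1 (funext h)
  simpa [huv] using congr_fun₂ hA u v

variable {G} in
lemma maxAdjEigenvalue_pos (hG : G ≠ ⊥) : 0 < G.maxAdjEigenvalue := by
  obtain ⟨j, hj⟩ := exists_adjEigenvalue_ne_zero hG
  obtain ⟨i, -, hi⟩ := Finset.exists_pos_of_sum_zero_of_exists_nonzero _
    (sum_adjEigenvalue G) ⟨j, Finset.mem_univ j, hj⟩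
  exact hi.trans_le (adjEigenvalue_le_maxAdjEigenvalue G i)

variable {G} in
lemma exists_adjEigenvalue_neg (hG : G ≠ ⊥) : ∃ i, G.adjEigenvalue i < 0 := by
  obtain ⟨j, hj⟩ := exists_adjEigenvalue_ne_zero hG
  obtain ⟨i, -, hi⟩ := Finset.exists_pos_of_sum_zero_of_exists_nonzero (fun i => -G.adjEigenvalue i)
    (by rw [Finset.sum_neg_distrib, sum_adjEigenvalue, neg_zero])
    ⟨j, Finset.mem_univ j, neg_ne_zero.2 hj⟩
  exact ⟨i, neg_pos.1 hi⟩

variable {G} in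
lemma minAdjEigenvalue_neg (hG : G ≠ ⊥) : G.minAdjEigenvalue < 0 :=
  let ⟨i, hi⟩ := exists_adjEigenvalue_neg hG
  (minAdjEigenvalue_le_adjEigenvalue G i).trans_lt hi

variable {G} in
lemma maxAdjEigenvalue_eq_of_isRegularOfDegree [Nonempty V] {d : ℕ}
    (hd : G.IsRegularOfDegree d) : G.maxAdjEigenvalue = d := by
  refine le_antisymm (ciSup_le fun i => ?_) ?_
  · obtain ⟨v, hv⟩ := eigenvalue_mem_ball ((hasEigenvalue_adjMatrix_iff G).2 ⟨i, rfl⟩)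
    have hsum : ∑ u, ‖G.adjMatrix ℝ v u‖ = d := by
      simp [adjMatrix_apply, apply_ite, ← hd.degree_eq v, ← card_neighborFinset_eq_degree,
        neighborFinset_eq_filter]
    rw [Finset.sum_erase _ (by simp), hsum, mem_closedBall_iff_norm] at hv
    exact (le_abs_self _).trans (by simpa using hv)
  · obtain ⟨i, hi⟩ := exists_adjEigenvalue_eq (G := G) (x := Function.const V (1 : ℝ))
      (Function.const_ne_zero.2 one_ne_zero) (μ := d) <| funext fun v => by
        simp [hd.degree_eq v]
    exact hi ▸ adjEigenvalue_le_maxAdjEigenvalue G i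

end AdjacencySpectrum

section IndependentSet

open SimpleGraph Matrix

variable {V R : Type*} [Fintype V] [CommRing R] {G : SimpleGraph V} [DecidableRel G.Adj]
  {s : Set V} {x : V → R}

lemma dotProduct_adjMatrix_mulVec_eq_zero_of_isIndepSet (hs : G.IsIndepSet s)
    (hx : ∀ v ∉ s, x v = 0) : x ⬝ᵥ G.adjMatrix R *ᵥ x = 0 := by
  refine Finset.sum_eq_zero fun v _ => ?_
  by_cases hv : v ∈ s
  · rw [adjMatrix_mulVec_apply, Finset.sum_eq_zero, mul_zero]
    intro u hu
    rw [mem_neighborFinset] at hu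
    exact hx u fun hus => hs hv hus hu.ne hu
  · rw [hx v hv, zero_mul]

lemma adjMatrix_mulVec_indicator_compl_of_isIndepSet (hs : G.IsIndepSet s) {v : V} (hv : v ∈ s) :
    (G.adjMatrix R *ᵥ sᶜ.indicator x) v = (G.adjMatrix R *ᵥ x) v := by
  simp only [adjMatrix_mulVec_apply]
  refine Finset.sum_congr rfl fun u hu => Set.indicator_of_mem (fun hus => ?_) x
  rw [mem_neighborFinset] at hu
  exact hs hv hus hu.ne hu

lemma dotProduct_adjMatrix_mulVec_indicator_compl (hs : G.IsIndepSet s)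
    (hx : ∀ v ∈ s, (G.adjMatrix R *ᵥ x) v = 0) :
    sᶜ.indicator x ⬝ᵥ G.adjMatrix R *ᵥ sᶜ.indicator x = x ⬝ᵥ G.adjMatrix R *ᵥ x := by
  have hindicator {z : V → R} (hz : ∀ v ∈ s, z v = 0) : sᶜ.indicator x ⬝ᵥ z = x ⬝ᵥ z :=
    Finset.sum_congr rfl fun v _ => by by_cases hv : v ∈ s <;> simp [hv, hz]
  have hsymm : sᶜ.indicator x ⬝ᵥ G.adjMatrix R *ᵥ x = x ⬝ᵥ G.adjMatrix R *ᵥ sᶜ.indicator x := by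
    rw [dotProduct_mulVec, ← mulVec_transpose, transpose_adjMatrix, dotProduct_comm]
  rw [hindicator fun v hv => by rw [adjMatrix_mulVec_indicator_compl_of_isIndepSet hs hv, hx v hv],
    ← hsymm, hindicator hx]

end IndependentSet

section InertiaBound

open SimpleGraph Matrix

variable {V : Type*} [Fintype V] [DecidableEq V] {G : SimpleGraph V} [DecidableRel G.Adj]

lemma inertiaBound_lt_card (hG : G ≠ ⊥) : G.inertiaBound < Fintype.card V := by
  obtain ⟨i, hi⟩ := exists_adjEigenvalue_neg hG
  exact (min_le_left _ _).trans_lt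
    (Finset.card_lt_univ_of_notMem (x := i) (by simpa using hi))

lemma finrank_le_inertiaBound {W : Submodule ℝ (V → ℝ)}
    (hW : ∀ x ∈ W, x ⬝ᵥ G.adjMatrix ℝ *ᵥ x = 0) : Module.finrank ℝ W ≤ G.inertiaBound :=
  le_min (finrank_le_card_eigenvalues_nonneg _ fun x hx => (hW x hx).ge)
    (finrank_le_card_eigenvalues_nonpos _ fun x hx => (hW x hx).le)

lemma card_nonneg_add_card_nonpos_of_ne_zero (hG : ∀ i, G.adjEigenvalue i ≠ 0) :
    (Finset.univ.filter fun i => 0 ≤ G.adjEigenvalue i).card +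
      (Finset.univ.filter fun i => G.adjEigenvalue i ≤ 0).card = Fintype.card V := by
  rw [← Finset.card_univ,
    ← Finset.card_filter_add_card_filter_not (s := Finset.univ) (fun i => 0 ≤ G.adjEigenvalue i)]
  simp only [not_le, (hG _).le_iff_lt]

lemma inertiaBound_add_finrank_le_of_nonneg (hG : ∀ i, G.adjEigenvalue i ≠ 0)
    {W : Submodule ℝ (V → ℝ)} (hW : ∀ x ∈ W, 0 ≤ x ⬝ᵥ G.adjMatrix ℝ *ᵥ x) :
    G.inertiaBound + Module.finrank ℝ W ≤ Fintype.card V := by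
  rw [← card_nonneg_add_card_nonpos_of_ne_zero hG, add_comm]
  exact add_le_add (finrank_le_card_eigenvalues_nonneg _ hW) (min_le_right _ _)

lemma inertiaBound_add_finrank_le_of_nonpos (hG : ∀ i, G.adjEigenvalue i ≠ 0)
    {W : Submodule ℝ (V → ℝ)} (hW : ∀ x ∈ W, x ⬝ᵥ G.adjMatrix ℝ *ᵥ x ≤ 0) :
    G.inertiaBound + Module.finrank ℝ W ≤ Fintype.card V := by
  rw [← card_nonneg_add_card_nonpos_of_ne_zero hG]
  exact add_le_add (min_le_left _ _) (finrank_le_card_eigenvalues_nonpos _ hW)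

theorem card_le_inertiaBound_of_isIndepSet {s : Finset V} (hs : G.IsIndepSet s) :
    s.card ≤ G.inertiaBound := by
  rw [← Set.ncard_coe_finset, ← Pi.dim_spanSubset (R := ℝ)]
  exact finrank_le_inertiaBound fun x hx =>
    dotProduct_adjMatrix_mulVec_eq_zero_of_isIndepSet hs (Pi.mem_spanSubset_iff.1 hx)

theorem indepNum_le_inertiaBound : G.indepNum ≤ G.inertiaBound := by
  obtain ⟨s, hs⟩ := G.exists_isNIndepSet_indepNum
  exact hs.card_eq ▸ card_le_inertiaBound_of_isIndepSet hs.isIndepSet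

end InertiaBound

section CvetkovicHoffman

open SimpleGraph Polynomial

variable {R : Type*} [CommRing R] in
lemma sub_mul_eval_of_natDegree_le_one {p : R[X]} (hp : p.natDegree ≤ 1) (x y z : R) :
    (x - y) * p.eval z = (z - y) * p.eval x + (x - z) * p.eval y := by
  obtain ⟨a, b, rfl⟩ := exists_eq_X_add_C_of_natDegree_le_one hp
  simp only [eval_add, eval_mul, eval_C, eval_X]
  ring

variable {F : Type*} [Field F] in
lemma X_eq_C_mul_sub_one_of_natDegree_le_one {p : F[X]} (hp : p.natDegree ≤ 1) {r : F}
    (hr : p.eval r = 0) (h0 : p.eval 0 ≠ 0) : X = C (-r) * (C (p.eval 0)⁻¹ * p - 1) := by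
  obtain ⟨a, b, rfl⟩ := exists_eq_X_add_C_of_natDegree_le_one hp
  simp only [eval_add, eval_mul, eval_C, eval_X, mul_zero, zero_add] at hr h0 ⊢
  have hab : -r * (b⁻¹ * a) = 1 := by
    field_simp
    linear_combination -hr
  rw [mul_add, ← C_mul, inv_mul_cancel₀ h0, C_1, add_sub_cancel_right, ← mul_assoc, ← mul_assoc,
    ← C_mul, ← C_mul, mul_assoc, hab, C_1, one_mul]

lemma tIndepNum_one {V : Type*} (G : SimpleGraph V) : G.tIndepNum 1 = G.indepNum := by
  have hdist {u v : V} (huv : u ≠ v) : ((1 : ℕ) : ℕ∞) < G.edist u v ↔ ¬ G.Adj u v := by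
    rw [← not_le, Nat.cast_one, edist_le_one_iff_adj_or_eq, or_iff_left huv]
  have hindep (s : Finset V) :
      (s : Set V).Pairwise (fun u v => ((1 : ℕ) : ℕ∞) < G.edist u v) ↔ G.IsIndepSet s :=
    forall₄_congr fun _ _ _ _ => forall_congr' hdist
  simp only [tIndepNum, indepNum, hindep, isNIndepSet_iff, and_comm]

variable {V : Type*} [Fintype V] [DecidableEq V] (G : SimpleGraph V) [DecidableRel G.Adj]

lemma isPartiallyWalkRegular_one : G.IsPartiallyWalkRegular 1 := by
  intro l hl u v
  interval_cases l <;> simp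

lemma polyTrace_of_natDegree_le_one {p : ℝ[X]} (hp : p.natDegree ≤ 1) :
    G.polyTrace p = Fintype.card V * p.eval 0 := by
  obtain ⟨a, b, rfl⟩ := exists_eq_X_add_C_of_natDegree_le_one hp
  simp [polyTrace, Finset.sum_add_distrib, ← Finset.mul_sum, sum_adjEigenvalue]

lemma isSignFeasible_one_iff [Nonempty V] {s : ℝ[X]} :
    G.IsSignFeasible 1 s ↔ ∃ a : ℝ, s = C a * X := by
  constructor
  · rintro ⟨hdeg, htrace⟩
    rw [polyTrace_of_natDegree_le_one G hdeg] at htrace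
    obtain ⟨a, b, rfl⟩ := exists_eq_X_add_C_of_natDegree_le_one hdeg
    exact ⟨a, by simpa using htrace⟩
  · rintro ⟨a, rfl⟩
    have hdeg : (C a * X).natDegree ≤ 1 := (natDegree_C_mul_le a X).trans natDegree_X_le
    exact ⟨hdeg, by simp [polyTrace_of_natDegree_le_one G hdeg]⟩

lemma signCount_C_mul_X_of_pos {a : ℝ} (ha : 0 < a) :
    G.signCount (C a * X) = (Finset.univ.filter fun i => 0 ≤ G.adjEigenvalue i).card := by
  simp [signCount, ha]

lemma signCount_C_mul_X_of_neg {a : ℝ} (ha : a < 0) :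
    G.signCount (C a * X) = (Finset.univ.filter fun i => G.adjEigenvalue i ≤ 0).card := by
  refine congrArg Finset.card (Finset.filter_congr fun i _ => ?_)
  rw [eval_mul, eval_C, eval_X]
  exact ⟨fun h => nonpos_of_mul_nonneg_right h ha, mul_nonneg_of_nonpos_of_nonpos ha.le⟩

lemma signCount_zero : G.signCount 0 = Fintype.card V := by
  simp [signCount]

lemma inertiaBound_le_signCount (a : ℝ) : G.inertiaBound ≤ G.signCount (C a * X) := by
  rcases lt_trichotomy a 0 with ha | rfl | ha
  · exact signCount_C_mul_X_of_neg G ha ▸ min_le_right _ _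
  · rw [C_0, zero_mul, signCount_zero]
    exact (min_le_left _ _).trans (Finset.card_le_univ _)
  · exact signCount_C_mul_X_of_pos G ha ▸ min_le_left _ _

lemma exists_signCount_eq_inertiaBound : ∃ a : ℝ, G.signCount (C a * X) = G.inertiaBound := by
  rcases min_choice (Finset.univ.filter fun i => 0 ≤ G.adjEigenvalue i).card
    (Finset.univ.filter fun i => G.adjEigenvalue i ≤ 0).card with h | h
  · exact ⟨1, by rw [signCount_C_mul_X_of_pos G one_pos, inertiaBound, h]⟩
  · exact ⟨-1, by rw [signCount_C_mul_X_of_neg G neg_one_lt_zero, inertiaBound, h]⟩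

lemma isSignPoly_one_iff [Nonempty V] {s : ℝ[X]} :
    G.IsSignPoly 1 s ↔ ∃ a : ℝ, s = C a * X ∧ G.signCount s = G.inertiaBound := by
  simp only [IsSignPoly, isSignFeasible_one_iff, forall_exists_index, forall_eq_apply_imp_iff]
  obtain ⟨b, hb⟩ := exists_signCount_eq_inertiaBound G
  constructor
  · rintro ⟨⟨a, rfl⟩, hmin⟩
    exact ⟨a, rfl, (hb ▸ hmin b).antisymm (inertiaBound_le_signCount G a)⟩
  · rintro ⟨a, ha, hs⟩
    exact ⟨⟨a, ha⟩, fun c => hs ▸ inertiaBound_le_signCount G c⟩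

variable {G}

lemma isMinorFeasible_one_of_eval_eq (hG : G ≠ ⊥) {f : ℝ[X]} (hdeg : f.natDegree ≤ 1)
    (hmax : f.eval G.maxAdjEigenvalue = 1) (hmin : f.eval G.minAdjEigenvalue = 0) :
    G.IsMinorFeasible 1 f := by
  refine ⟨hdeg, hmax, fun i _ => ?_⟩
  have hpos : 0 < G.maxAdjEigenvalue - G.minAdjEigenvalue := by
    linarith [maxAdjEigenvalue_pos hG, minAdjEigenvalue_neg hG]
  refine nonneg_of_mul_nonneg_right ?_ hpos
  rw [sub_mul_eval_of_natDegree_le_one hdeg, hmax, hmin, mul_one, mul_zero, add_zero, sub_nonneg]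
  exact minAdjEigenvalue_le_adjEigenvalue G i

lemma eval_minAdjEigenvalue_nonneg_of_isMinorFeasible (hG : G ≠ ⊥) {t : ℕ}
    {f : ℝ[X]} (hf : G.IsMinorFeasible t f) : 0 ≤ f.eval G.minAdjEigenvalue := by
  have : Nontrivial V := SimpleGraph.nontrivial_iff.1 ⟨_, _, hG⟩
  obtain ⟨i, hi⟩ : ∃ i, G.adjEigenvalue i = G.minAdjEigenvalue := exists_eq_ciInf_of_finite
  refine hi ▸ hf.2.2 i ?_
  rw [hi]
  exact ((minAdjEigenvalue_neg hG).trans (maxAdjEigenvalue_pos hG)).ne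

lemma sub_mul_polyTrace_of_isMinorFeasible_one {f : ℝ[X]} (hf : G.IsMinorFeasible 1 f) :
    (G.maxAdjEigenvalue - G.minAdjEigenvalue) * G.polyTrace f =
      Fintype.card V * (G.maxAdjEigenvalue * f.eval G.minAdjEigenvalue - G.minAdjEigenvalue) := by
  rw [polyTrace_of_natDegree_le_one G hf.1, mul_left_comm,
    sub_mul_eval_of_natDegree_le_one hf.1, hf.2.1]
  ring

variable (G) in
lemma ratioBound_eq_div_sub (hmin : G.minAdjEigenvalue ≠ 0) : G.ratioBound =
    Fintype.card V * -G.minAdjEigenvalue / (G.maxAdjEigenvalue - G.minAdjEigenvalue) := by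
  rw [ratioBound, one_sub_div hmin, div_div_eq_mul_div, ← neg_sub, div_neg, mul_neg, neg_div]

lemma polyTrace_eq_ratioBound_add (hG : G ≠ ⊥) {f : ℝ[X]} (hf : G.IsMinorFeasible 1 f) :
    G.polyTrace f = G.ratioBound + Fintype.card V * G.maxAdjEigenvalue /
      (G.maxAdjEigenvalue - G.minAdjEigenvalue) * f.eval G.minAdjEigenvalue := by
  have hmin := minAdjEigenvalue_neg hG
  have hsub : G.maxAdjEigenvalue - G.minAdjEigenvalue ≠ 0 := by
    linarith [maxAdjEigenvalue_pos hG]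
  rw [ratioBound_eq_div_sub G hmin.ne]
  field_simp
  linear_combination sub_mul_polyTrace_of_isMinorFeasible_one hf

lemma exists_isMinorFeasible_one_eval_min_eq_zero (hG : G ≠ ⊥) :
    ∃ f, G.IsMinorFeasible 1 f ∧ f.eval G.minAdjEigenvalue = 0 := by
  have hsub : G.maxAdjEigenvalue - G.minAdjEigenvalue ≠ 0 := by
    linarith [maxAdjEigenvalue_pos hG, minAdjEigenvalue_neg hG]
  have hmin : (C (G.maxAdjEigenvalue - G.minAdjEigenvalue)⁻¹ *
      (X - C G.minAdjEigenvalue)).eval G.minAdjEigenvalue = 0 := by simp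
  exact ⟨_, isMinorFeasible_one_of_eval_eq hG
    ((natDegree_C_mul_le _ _).trans (natDegree_X_sub_C_le _)) (by simp [hsub]) hmin, hmin⟩

lemma isMinorPoly_one_iff (hG : G ≠ ⊥) {f : ℝ[X]} :
    G.IsMinorPoly 1 f ↔ G.IsMinorFeasible 1 f ∧ f.eval G.minAdjEigenvalue = 0 := by
  have : Nontrivial V := SimpleGraph.nontrivial_iff.1 ⟨_, _, hG⟩
  have hmax := maxAdjEigenvalue_pos hG
  have hcoeff : 0 < Fintype.card V * G.maxAdjEigenvalue /
      (G.maxAdjEigenvalue - G.minAdjEigenvalue) :=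
    div_pos (mul_pos (Nat.cast_pos.2 Fintype.card_pos) hmax)
      (by linarith [minAdjEigenvalue_neg hG])
  obtain ⟨g, hg, hg0⟩ := exists_isMinorFeasible_one_eval_min_eq_zero hG
  refine and_congr_right fun hf => ⟨fun hopt => ?_, fun hf0 p hp => ?_⟩
  · have hle := hopt g hg
    rw [polyTrace_eq_ratioBound_add hG hf, polyTrace_eq_ratioBound_add hG hg,
      add_le_add_iff_left, mul_le_mul_iff_right₀ hcoeff, hg0] at hle
    exact hle.antisymm (eval_minAdjEigenvalue_nonneg_of_isMinorFeasible hG hf)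
  · rw [polyTrace_eq_ratioBound_add hG hf, polyTrace_eq_ratioBound_add hG hp,
      add_le_add_iff_left, mul_le_mul_iff_right₀ hcoeff, hf0]
    exact eval_minAdjEigenvalue_nonneg_of_isMinorFeasible hG hp

lemma polyTrace_eq_ratioBound (hG : G ≠ ⊥) {f : ℝ[X]} (hf : G.IsMinorPoly 1 f) :
    G.polyTrace f = G.ratioBound := by
  obtain ⟨hfeas, hmin⟩ := (isMinorPoly_one_iff hG).1 hf
  rw [polyTrace_eq_ratioBound_add hG hfeas, hmin, mul_zero, add_zero]

lemma linearlyRelated_of_isSignPoly_one (hG : G ≠ ⊥) {s f : ℝ[X]}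
    (hs : G.IsSignPoly 1 s) (hf : G.IsMinorPoly 1 f) : G.LinearlyRelated s f := by
  have : Nontrivial V := SimpleGraph.nontrivial_iff.1 ⟨_, _, hG⟩
  obtain ⟨a, rfl, ha⟩ := (isSignPoly_one_iff G).1 hs
  obtain ⟨hfeas, hf0⟩ := (isMinorPoly_one_iff hG).1 hf
  have ha0 : a ≠ 0 := by
    rintro rfl
    rw [C_0, zero_mul, signCount_zero] at ha
    exact (inertiaBound_lt_card hG).ne' ha
  have hmin := (minAdjEigenvalue_neg hG).ne
  have hf_zero : f.eval 0 ≠ 0 := fun h => by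
    have hzero := sub_mul_eval_of_natDegree_le_one hfeas.1 G.maxAdjEigenvalue G.minAdjEigenvalue 0
    rw [h, hfeas.2.1, hf0] at hzero
    simp [hmin] at hzero
  have hcard : (Fintype.card V : ℝ) ≠ 0 := by simp
  refine ⟨a * -G.minAdjEigenvalue, mul_ne_zero ha0 (neg_ne_zero.2 hmin), ?_⟩
  rw [polyTrace_of_natDegree_le_one G hfeas.1, div_mul_cancel_left₀ hcard, C_mul, mul_assoc,
    ← X_eq_C_mul_sub_one_of_natDegree_le_one hfeas.1 hf0 hf_zero]

theorem isTightCvetkovicHoffman_one [Nontrivial V] (hconn : G.Connected)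
    (hreg : ∃ r, G.IsRegularOfDegree r) (hinertia : G.inertiaBound = G.indepNum)
    (hratio : G.ratioBound = G.indepNum) : G.IsTightCvetkovicHoffman 1 := by
  have hG : G ≠ ⊥ := by
    rintro rfl
    exact not_connected_bot hconn
  have hsign {s : ℝ[X]} (hs : G.IsSignPoly 1 s) : G.signCount s = G.tIndepNum 1 := by
    obtain ⟨a, -, hcount⟩ := (isSignPoly_one_iff G).1 hs
    rw [hcount, hinertia, tIndepNum_one]
  have hminor {f : ℝ[X]} (hf : G.IsMinorPoly 1 f) : G.polyTrace f = G.tIndepNum 1 := by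
    rw [polyTrace_eq_ratioBound hG hf, hratio, tIndepNum_one]
  obtain ⟨a, ha⟩ := exists_signCount_eq_inertiaBound G
  exact {
    connected := hconn
    regular := hreg
    walkRegular := isPartiallyWalkRegular_one G
    exists_sign := ⟨_, (isSignPoly_one_iff G).2 ⟨a, rfl, ha⟩⟩
    exists_minor :=
      let ⟨f, hf⟩ := exists_isMinorFeasible_one_eval_min_eq_zero hG
      ⟨f, (isMinorPoly_one_iff hG).2 hf⟩
    related := fun _ _ => linearlyRelated_of_isSignPoly_one hG
    bounds_eq := fun _ _ hs hf => by rw [hsign hs, hminor hf]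
    sign_tight := fun _ => hsign
    minor_tight := fun _ => hminor }

end CvetkovicHoffman

section SubsetSums

open Finset

variable {α ι R : Type*} [DecidableEq α] [Ring R]

lemma sum_powerset_filter_subset_neg_one_pow_card (J S : Finset α) :
    ∑ I ∈ J.powerset with I ⊆ S, (-1 : R) ^ #I = if Disjoint J S then 1 else 0 := by
  have hfilter : J.powerset.filter (· ⊆ S) = (J ∩ S).powerset := by
    ext I
    simp only [mem_filter, mem_powerset, subset_inter_iff]
  have hsum := congrArg (Int.cast : ℤ → R) (sum_powerset_neg_one_pow_card (x := J ∩ S))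
  push_cast at hsum
  simp only [hfilter, hsum, disjoint_iff_inter_eq_empty]

lemma sum_powerset_filter_disjoint_neg_one_pow_card (J S : Finset α) :
    ∑ I ∈ J.powerset with Disjoint I S, (-1 : R) ^ #I = if J ⊆ S then 1 else 0 := by
  have hfilter : J.powerset.filter (Disjoint · S) = (J \ S).powerset := by
    ext I
    simp only [mem_filter, mem_powerset, subset_sdiff]
  have hsum := congrArg (Int.cast : ℤ → R) (sum_powerset_neg_one_pow_card (x := J \ S))
  push_cast at hsum
  simp only [hfilter, hsum, sdiff_eq_empty_iff_subset]

lemma card_powersetCard_filter_subset_disjoint {X J : Finset α} (S : Finset α) {m : ℕ}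
    (hJ : J ⊆ X) (hm : #J ≤ m) :
    #{T ∈ X.powersetCard m | J ⊆ T ∧ Disjoint T S} =
      if Disjoint J S then (#(X \ S) - #J).choose (m - #J) else 0 := by
  split_ifs with h
  · rw [← card_filter_powersetCard_subset J (X \ S) m (subset_sdiff.2 ⟨hJ, h⟩) hm]
    congr 1
    ext T
    simp only [mem_filter, mem_powersetCard, subset_sdiff]
    tauto
  · rw [card_eq_zero, filter_eq_empty_iff]
    exact fun T _ hT => h (hT.2.mono_left hT.1)

variable [Fintype ι] (F : ι → Finset α) (y : ι → R)

/-- The sum of the weights `y` over the members of the set family `F` that contain `J`. Together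
with `disjointSum` it carries the inclusion–exclusion arguments about the Kneser graph. -/
def supersetSum (J : Finset α) : R := ∑ i with J ⊆ F i, y i

/-- The sum of the weights `y` over the members of the set family `F` that are disjoint from `J`.
When `F` lists the `k`-subsets and `#J = k`, this is the action of the adjacency matrix of the
Kneser graph. -/
def disjointSum (J : Finset α) : R := ∑ i with Disjoint J (F i), y i

lemma disjointSum_eq_sum_powerset (J : Finset α) :
    disjointSum F y J = ∑ I ∈ J.powerset, (-1) ^ #I * supersetSum F y I := by
  simp only [disjointSum, supersetSum, mul_sum, sum_filter]
  rw [sum_comm]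
  refine sum_congr rfl fun i _ => ?_
  simp only [← sum_filter, ← sum_mul, sum_powerset_filter_subset_neg_one_pow_card,
    mul_ite, mul_zero, ite_mul, one_mul, zero_mul]

lemma supersetSum_eq_sum_powerset (J : Finset α) :
    supersetSum F y J = ∑ I ∈ J.powerset, (-1) ^ #I * disjointSum F y I := by
  simp only [disjointSum, supersetSum, mul_sum, sum_filter]
  rw [sum_comm]
  refine sum_congr rfl fun i _ => ?_
  simp only [← sum_filter, ← sum_mul, sum_powerset_filter_disjoint_neg_one_pow_card,
    mul_ite, mul_zero, ite_mul, one_mul, zero_mul]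

variable {F y}

lemma disjointSum_eq_of_forall_ssubset {J : Finset α} (h : ∀ I ⊂ J, supersetSum F y I = 0) :
    disjointSum F y J = (-1) ^ #J * supersetSum F y J := by
  rw [disjointSum_eq_sum_powerset, sum_eq_single_of_mem J (mem_powerset_self J)]
  intro I hI hIJ
  rw [h I ((mem_powerset.1 hI).ssubset_of_ne hIJ), mul_zero]

lemma supersetSum_eq_of_forall_ssubset {J : Finset α} (h : ∀ I ⊂ J, disjointSum F y I = 0) :
    supersetSum F y J = (-1) ^ #J * disjointSum F y J := by
  rw [supersetSum_eq_sum_powerset, sum_eq_single_of_mem J (mem_powerset_self J)]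
  intro I hI hIJ
  rw [h I ((mem_powerset.1 hI).ssubset_of_ne hIJ), mul_zero]

lemma supersetSum_subtypeVal {k : ℕ} [Fintype {s : Finset α // #s = k}]
    (y : {s : Finset α // #s = k} → R) (S : {s : Finset α // #s = k}) :
    supersetSum Subtype.val y S.1 = y S := by
  have hfilter (T : {s : Finset α // #s = k}) : S.1 ⊆ T.1 ↔ T = S :=
    ⟨fun h => Subtype.ext (eq_of_subset_of_card_le h (by rw [S.2, T.2])).symm,
      fun h => h ▸ subset_rfl⟩
  simp only [supersetSum, hfilter, filter_eq', mem_univ, if_true, sum_singleton]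

lemma sum_powersetCard_disjointSum {X J : Finset α} {m c : ℕ} (hJ : J ⊆ X) (hm : #J ≤ m)
    (hc : ∀ i, y i ≠ 0 → #(X \ F i) = c) :
    ∑ T ∈ X.powersetCard m with J ⊆ T, disjointSum F y T =
      (c - #J).choose (m - #J) * disjointSum F y J := by
  simp only [disjointSum]
  rw [sum_comm' (t' := univ) (s' := fun i => {T ∈ X.powersetCard m | J ⊆ T ∧ Disjoint T (F i)})
    (by simp only [mem_filter, mem_univ, true_and, and_true, and_assoc, implies_true]),
    mul_sum, sum_filter]
  refine sum_congr rfl fun i _ => ?_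
  rw [sum_const, card_powersetCard_filter_subset_disjoint _ hJ hm, nsmul_eq_mul]
  obtain hi | hi := eq_or_ne (y i) 0
  · simp only [hi, mul_zero, ite_self]
  · simp only [hc i hi, Nat.cast_ite, Nat.cast_zero, ite_mul, zero_mul]

end SubsetSums

section Binomial

lemma choose_sub_sub_le_choose {a b j : ℕ} (hj : j ≤ b) (hab : b ≤ a) :
    (a - j).choose (b - j) ≤ a.choose b := by
  rw [← Nat.choose_symm hab, ← Nat.choose_symm (Nat.sub_le_sub_right hab j),
    Nat.sub_sub_sub_cancel_right hj]
  exact Nat.choose_le_choose _ (Nat.sub_le _ _)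

lemma cast_choose_eq_div_mul {K : Type*} [Field K] [CharZero K] (n : ℕ) {k : ℕ} (hk : k ≠ 0) :
    (n.choose k : K) = n / k * (n - 1).choose (k - 1) := by
  obtain ⟨k, rfl⟩ := Nat.exists_eq_succ_of_ne_zero hk
  rw [div_mul_eq_mul_div, eq_div_iff (Nat.cast_ne_zero.2 hk)]
  cases n with
  | zero => simp
  | succ n => exact_mod_cast (Nat.add_one_mul_choose_eq n k).symm

end Binomial

section Kneser

open SimpleGraph Matrix Finset

variable {n k : ℕ}

section UniformFamily

variable {α : Type*} [Fintype α]

lemma sum_subtype_card_filter {M : Type*} [AddCommMonoid M] (p : Finset α → Prop)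
    [DecidablePred p] (f : Finset α → M) :
    ∑ S : {s : Finset α // #s = k} with p S.1, f S.1 = ∑ T ∈ univ.powersetCard k with p T, f T := by
  rw [sum_filter, sum_filter,
    sum_subtype (p := fun s => #s = k) (univ.powersetCard k) (by simp)]

lemma card_subtype_card_filter_subset_disjoint [DecidableEq α] {J : Finset α} (hJ : #J ≤ k)
    (S : Finset α) :
    #{T : {s : Finset α // #s = k} | J ⊆ T.1 ∧ Disjoint T.1 S} =
      if Disjoint J S then (Fintype.card α - #S - #J).choose (k - #J) else 0 := by
  rw [card_eq_sum_ones, sum_subtype_card_filter (fun T => J ⊆ T ∧ Disjoint T S) fun _ => 1,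
    ← card_eq_sum_ones, card_powersetCard_filter_subset_disjoint S (subset_univ J) hJ,
    card_univ_sdiff]

end UniformFamily

lemma kneserGraph_adj_iff_disjoint (hk : 1 ≤ k) {S T : {s : Finset (Fin n) // #s = k}} :
    (kneserGraph n k).Adj S T ↔ Disjoint S.1 T.1 := by
  refine ⟨And.right, fun h => ⟨?_, h⟩⟩
  rintro rfl
  exact (card_pos.1 (hk.trans_eq S.2.symm)).ne_empty ((disjoint_self_iff_empty _).1 h)

lemma nontrivial_kneserGraph_vertex (hk : 1 ≤ k) (hn : k < n) :
    Nontrivial {s : Finset (Fin n) // #s = k} := by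
  rw [← Fintype.one_lt_card_iff_nontrivial, Fintype.card_finset_len, Fintype.card_fin]
  have hpos := Nat.choose_pos hn.le
  have hne : n.choose k ≠ 1 := by
    rw [Ne, Nat.choose_eq_one_iff]
    omega
  omega

lemma isRegularOfDegree_kneserGraph (hk : 1 ≤ k) :
    (kneserGraph n k).IsRegularOfDegree ((n - k).choose k) := fun S => by
  have hcard :=
    card_subtype_card_filter_subset_disjoint (k := k) (card_empty.trans_le k.zero_le) S.1
  rw [if_pos (disjoint_empty_left _)] at hcard
  simp only [empty_subset, true_and, Fintype.card_fin, S.2, card_empty, Nat.sub_zero,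
    disjoint_comm (b := S.1)] at hcard
  rw [← card_neighborFinset_eq_degree, neighborFinset_eq_filter, ← hcard]
  simp only [kneserGraph_adj_iff_disjoint hk]

section AdjMatrix

variable {R : Type*} [CommRing R] {y : {s : Finset (Fin n) // #s = k} → R}

lemma kneserGraph_adjMatrix_mulVec_apply (hk : 1 ≤ k) (S : {s : Finset (Fin n) // #s = k}) :
    ((kneserGraph n k).adjMatrix R *ᵥ y) S = disjointSum Subtype.val y S.1 := by
  simp only [adjMatrix_mulVec_apply, neighborFinset_eq_filter, kneserGraph_adj_iff_disjoint hk,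
    disjointSum]

lemma supersetSum_kneserGraph_adjMatrix_mulVec (hk : 1 ≤ k) {J : Finset (Fin n)} (hJ : #J ≤ k) :
    supersetSum Subtype.val ((kneserGraph n k).adjMatrix R *ᵥ y) J =
      (n - k - #J).choose (k - #J) * disjointSum Subtype.val y J := by
  simp only [supersetSum, kneserGraph_adjMatrix_mulVec_apply hk]
  rw [sum_subtype_card_filter (J ⊆ ·)]
  exact sum_powersetCard_disjointSum (subset_univ J) hJ fun S _ => by
    rw [card_univ_sdiff, S.2, Fintype.card_fin]

lemma exists_eigenvalue_kneserGraph_eq [NoZeroDivisors R] (hk : 1 ≤ k) (hy : y ≠ 0) {μ : R}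
    (hμ : (kneserGraph n k).adjMatrix R *ᵥ y = μ • y) :
    ∃ j ≤ k, μ = (-1) ^ j * (n - k - j).choose (k - j) := by
  obtain ⟨S, hS⟩ := Function.ne_iff.1 hy
  obtain ⟨J, hJS, hJ⟩ := exists_minimal_le_of_wellFoundedLT
    (fun J => supersetSum Subtype.val y J ≠ 0) S.1 (by rwa [supersetSum_subtypeVal])
  have hJk : #J ≤ k := (card_le_card hJS).trans S.2.le
  have hdisj := disjointSum_eq_of_forall_ssubset fun I hI => not_not.1 (hJ.not_prop_of_lt hI)
  have hsup := supersetSum_kneserGraph_adjMatrix_mulVec (y := y) hk hJk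
  have hsmul : supersetSum Subtype.val (μ • y) J = μ * supersetSum Subtype.val y J := by
    simp only [supersetSum, Pi.smul_apply, smul_eq_mul, mul_sum]
  rw [hμ, hsmul, hdisj] at hsup
  refine ⟨#J, hJk, mul_right_cancel₀ hJ.prop ?_⟩
  rw [hsup]
  ring

end AdjMatrix

lemma exists_adjEigenvalue_kneserGraph_eq (hk : 1 ≤ k) (i : {s : Finset (Fin n) // #s = k}) :
    ∃ j ≤ k, (kneserGraph n k).adjEigenvalue i = (-1) ^ j * (n - k - j).choose (k - j) := by
  obtain ⟨y, hy⟩ :=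
    ((hasEigenvalue_adjMatrix_iff (kneserGraph n k)).2 ⟨i, rfl⟩).exists_hasEigenvector
  exact exists_eigenvalue_kneserGraph_eq hk hy.2 hy.apply_eq_smul

lemma adjEigenvalue_kneserGraph_ne_zero (hk : 1 ≤ k) (hn : 2 * k ≤ n)
    (i : {s : Finset (Fin n) // #s = k}) : (kneserGraph n k).adjEigenvalue i ≠ 0 := by
  obtain ⟨j, hj, hi⟩ := exists_adjEigenvalue_kneserGraph_eq hk i
  have hchoose := Nat.choose_pos (by omega : k - j ≤ n - k - j)
  exact hi ▸ mul_ne_zero (pow_ne_zero _ (by norm_num)) (by exact_mod_cast hchoose.ne')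

/-- The star of `a` in the Kneser graph: the `k`-subsets that contain `a`. -/
def kneserStar (n k : ℕ) (a : Fin n) : Finset {s : Finset (Fin n) // #s = k} := {S | a ∈ S.1}

lemma mem_kneserStar {a : Fin n} {S : {s : Finset (Fin n) // #s = k}} :
    S ∈ kneserStar n k a ↔ a ∈ S.1 := by
  simp [kneserStar]

lemma card_kneserStar (hk : 1 ≤ k) (a : Fin n) : #(kneserStar n k a) = (n - 1).choose (k - 1) := by
  have hcard := card_subtype_card_filter_subset_disjoint (k := k) (J := {a}) hk ∅
  simpa [kneserStar] using hcard

lemma isIndepSet_kneserStar (a : Fin n) : (kneserGraph n k).IsIndepSet (kneserStar n k a) :=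
  fun _ hS _ hT _ hST => disjoint_left.1 hST.2 (mem_kneserStar.1 hS) (mem_kneserStar.1 hT)

lemma kneserGraph_adjMatrix_mulVec_indicator_kneserStar {R : Type*} [CommRing R] (hk : 1 ≤ k)
    (a : Fin n) :
    (kneserGraph n k).adjMatrix R *ᵥ (kneserStar n k a : Set _).indicator 1 =
      ((n - k - 1).choose (k - 1) : R) • (1 - (kneserStar n k a : Set _).indicator 1) := by
  ext S
  have hcard := card_subtype_card_filter_subset_disjoint (k := k) (J := {a}) hk S.1
  simp only [singleton_subset_iff, S.2, Fintype.card_fin, card_singleton,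
    disjoint_singleton_left] at hcard
  have hsum : disjointSum Subtype.val
      ((kneserStar n k a : Set _).indicator (1 : {s : Finset (Fin n) // #s = k} → R)) S.1 =
        #{T : {s : Finset (Fin n) // #s = k} | a ∈ T.1 ∧ Disjoint T.1 S.1} := by
    simp [disjointSum, Set.indicator_apply, mem_kneserStar, filter_filter, and_comm,
      disjoint_comm (a := S.1)]
  rw [kneserGraph_adjMatrix_mulVec_apply hk, hsum, hcard]
  by_cases ha : a ∈ S.1 <;> simp [ha, mem_kneserStar]

lemma exists_adjEigenvalue_kneserGraph_eq_neg_choose (hk : 1 ≤ k) (hn : k < n) :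
    ∃ i, (kneserGraph n k).adjEigenvalue i = -((n - k - 1).choose (k - 1) : ℝ) := by
  let a : Fin n := ⟨0, by omega⟩
  let b : Fin n := ⟨1, by omega⟩
  have hab : a ≠ b := by simp [a, b]
  obtain ⟨S, haS, hSb, hS⟩ := exists_subsuperset_card_eq (s := {a}) (t := {b}ᶜ) (n := k)
    (by simpa using hab.symm) (by simpa) (by simp [card_compl]; omega)
  refine exists_adjEigenvalue_eq (x := (kneserStar n k a : Set _).indicator 1 -
    (kneserStar n k b : Set _).indicator 1) (Function.ne_iff.2 ⟨⟨S, hS⟩, ?_⟩) ?_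
  · have ha : a ∈ S := singleton_subset_iff.1 haS
    have hb : b ∉ S := fun h => by simpa using hSb h
    simp [ha, hb, mem_kneserStar]
  · rw [mulVec_sub, kneserGraph_adjMatrix_mulVec_indicator_kneserStar hk,
      kneserGraph_adjMatrix_mulVec_indicator_kneserStar hk]
    module

lemma minAdjEigenvalue_kneserGraph (hk : 1 ≤ k) (hn : 2 * k ≤ n) :
    (kneserGraph n k).minAdjEigenvalue = -((n - k - 1).choose (k - 1) : ℝ) := by
  obtain ⟨i₀, hi₀⟩ := exists_adjEigenvalue_kneserGraph_eq_neg_choose hk (by omega : k < n)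
  have : Nonempty {s : Finset (Fin n) // #s = k} := ⟨i₀⟩
  refine le_antisymm (hi₀ ▸ minAdjEigenvalue_le_adjEigenvalue _ i₀) (le_ciInf fun i => ?_)
  obtain ⟨j, hj, hi⟩ := exists_adjEigenvalue_kneserGraph_eq hk i
  rw [hi]
  rcases Nat.even_or_odd j with hparity | hparity
  · rw [hparity.neg_one_pow, one_mul]
    exact (neg_nonpos.2 (Nat.cast_nonneg _)).trans (Nat.cast_nonneg _)
  · rw [hparity.neg_one_pow, neg_one_mul, neg_le_neg_iff, Nat.cast_le]
    have hpos := hparity.pos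
    have hle := choose_sub_sub_le_choose (a := n - k - 1) (b := k - 1) (j := j - 1) (by omega)
      (by omega)
    rwa [show n - k - 1 - (j - 1) = n - k - j by omega,
      show k - 1 - (j - 1) = k - j by omega] at hle

theorem ratioBound_kneserGraph (hk : 1 ≤ k) (hn : 2 * k ≤ n) :
    (kneserGraph n k).ratioBound = ((n - 1).choose (k - 1) : ℝ) := by
  have := nontrivial_kneserGraph_vertex hk (by omega : k < n)
  have hμ : ((n - k - 1).choose (k - 1) : ℝ) ≠ 0 :=
    Nat.cast_ne_zero.2 (Nat.choose_pos (by omega)).ne'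
  have hk' : (k : ℝ) ≠ 0 := by positivity
  have hn' : (n : ℝ) ≠ 0 := Nat.cast_ne_zero.2 (by omega)
  rw [ratioBound, maxAdjEigenvalue_eq_of_isRegularOfDegree (isRegularOfDegree_kneserGraph hk),
    minAdjEigenvalue_kneserGraph hk hn, Fintype.card_finset_len, Fintype.card_fin,
    cast_choose_eq_div_mul n (by omega), cast_choose_eq_div_mul (n - k) (by omega),
    Nat.cast_sub (by omega), div_neg, sub_neg_eq_add, mul_div_cancel_right₀ _ hμ,
    one_add_div hk', add_sub_cancel, mul_div_cancel_left₀ _ (div_ne_zero hn' hk')]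

section StarVanishing

variable {R : Type*} [CommRing R] {y : {s : Finset (Fin n) // #s = k} → R} {a : Fin n}

lemma disjointSum_eq_zero_of_vanishing_on_kneserStar [NoZeroDivisors R] [CharZero R] (hk : 1 ≤ k)
    (hn : 2 * k ≤ n) (hy : ∀ S ∈ kneserStar n k a, y S = 0)
    (hAy : ∀ S ∈ kneserStar n k a, ((kneserGraph n k).adjMatrix R *ᵥ y) S = 0)
    {J : Finset (Fin n)} (ha : a ∉ J) (hJ : #J < k) : disjointSum Subtype.val y J = 0 := by
  have hfacet (T) (hT : T ∈ (univ.erase a).powersetCard (k - 1)) :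
      disjointSum Subtype.val y T = 0 := by
    obtain ⟨hTa, hTcard⟩ := mem_powersetCard.1 hT
    have hcard : #(insert a T) = k := by
      rw [card_insert_of_notMem fun h => notMem_erase a _ (hTa h), hTcard, Nat.sub_add_cancel hk]
    rw [← hAy ⟨_, hcard⟩ (mem_kneserStar.2 (mem_insert_self a T)),
      kneserGraph_adjMatrix_mulVec_apply hk, disjointSum, disjointSum, sum_filter, sum_filter]
    refine sum_congr rfl fun S _ => ?_
    by_cases haS : a ∈ S.1
    · simp only [hy S (mem_kneserStar.2 haS), ite_self]
    · simp only [disjoint_insert_left, haS, not_false_eq_true, true_and]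
  have hcompl (S) (hS : y S ≠ 0) : #(univ.erase a \ S.1) = n - k - 1 := by
    have haS : a ∈ univ \ S.1 :=
      mem_sdiff.2 ⟨mem_univ a, fun h => hS (hy S (mem_kneserStar.2 h))⟩
    rw [erase_sdiff_comm, card_erase_of_mem haS, card_univ_sdiff, Fintype.card_fin, S.2]
  have hsum := sum_powersetCard_disjointSum (m := k - 1)
    (subset_erase.2 ⟨subset_univ J, ha⟩) (Nat.le_sub_one_of_lt hJ) hcompl
  rw [sum_eq_zero fun T hT => hfacet T (mem_filter.1 hT).1] at hsum
  have hchoose := Nat.choose_pos (by omega : k - 1 - #J ≤ n - k - 1 - #J)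
  exact (mul_eq_zero.1 hsum.symm).resolve_left (Nat.cast_ne_zero.2 hchoose.ne')

lemma kneserGraph_adjMatrix_mulVec_eq_of_vanishing_on_kneserStar [NoZeroDivisors R] [CharZero R]
    (hk : 1 ≤ k) (hn : 2 * k ≤ n) (hy : ∀ S ∈ kneserStar n k a, y S = 0)
    (hAy : ∀ S ∈ kneserStar n k a, ((kneserGraph n k).adjMatrix R *ᵥ y) S = 0) :
    (kneserGraph n k).adjMatrix R *ᵥ y = ((-1) ^ k : R) • y := by
  ext S
  rw [Pi.smul_apply, smul_eq_mul]
  by_cases haS : S ∈ kneserStar n k a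
  · rw [hAy S haS, hy S haS, mul_zero]
  have hdisj (I) (hI : I ⊂ S.1) : disjointSum Subtype.val y I = 0 :=
    disjointSum_eq_zero_of_vanishing_on_kneserStar hk hn hy hAy
      (fun h => haS (mem_kneserStar.2 (hI.subset h))) ((card_lt_card hI).trans_eq S.2)
  rw [kneserGraph_adjMatrix_mulVec_apply hk, ← supersetSum_subtypeVal y S,
    supersetSum_eq_of_forall_ssubset hdisj, S.2, ← mul_assoc, ← mul_pow, neg_one_mul, neg_neg,
    one_pow, one_mul]

end StarVanishing

lemma dotProduct_kneserGraph_adjMatrix_mulVec_eq {R : Type*} [CommRing R] [NoZeroDivisors R]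
    [CharZero R] (hk : 1 ≤ k) (hn : 2 * k ≤ n) {a : Fin n}
    {x : {s : Finset (Fin n) // #s = k} → R}
    (hx : ∀ S ∈ kneserStar n k a, ((kneserGraph n k).adjMatrix R *ᵥ x) S = 0) :
    x ⬝ᵥ (kneserGraph n k).adjMatrix R *ᵥ x = (-1) ^ k *
      ((kneserStar n k a : Set _)ᶜ.indicator x ⬝ᵥ (kneserStar n k a : Set _)ᶜ.indicator x) := by
  have hstar := isIndepSet_kneserStar (k := k) a
  rw [← dotProduct_adjMatrix_mulVec_indicator_compl hstar hx,
    kneserGraph_adjMatrix_mulVec_eq_of_vanishing_on_kneserStar (a := a) hk hn,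
    dotProduct_smul, smul_eq_mul]
  · exact fun S hS => Set.indicator_of_notMem (not_not.2 hS) x
  · exact fun S hS => by
      rw [adjMatrix_mulVec_indicator_compl_of_isIndepSet hstar hS, hx S hS]

lemma inertiaBound_kneserGraph_le (hk : 1 ≤ k) (hn : 2 * k ≤ n) :
    (kneserGraph n k).inertiaBound ≤ (n - 1).choose (k - 1) := by
  let a : Fin n := ⟨0, by omega⟩
  let restrict : ({s : Finset (Fin n) // #s = k} → ℝ) →ₗ[ℝ] kneserStar n k a → ℝ :=
    LinearMap.funLeft ℝ ℝ Subtype.val ∘ₗ ((kneserGraph n k).adjMatrix ℝ).mulVecLin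
  have hform (x) (hx : x ∈ restrict.ker) :=
    dotProduct_kneserGraph_adjMatrix_mulVec_eq hk hn (x := x) fun S hS => congrFun hx ⟨S, hS⟩
  have hsq (x : {s : Finset (Fin n) // #s = k} → ℝ) : 0 ≤ x ⬝ᵥ x := dotProduct_self_star_nonneg x
  have hne := adjEigenvalue_kneserGraph_ne_zero hk hn
  have hker : (kneserGraph n k).inertiaBound + Module.finrank ℝ restrict.ker ≤
      Fintype.card {s : Finset (Fin n) // #s = k} := by
    rcases Nat.even_or_odd k with hparity | hparity
    · refine inertiaBound_add_finrank_le_of_nonneg hne fun x hx => ?_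
      rw [hform x hx, hparity.neg_one_pow, one_mul]
      exact hsq _
    · refine inertiaBound_add_finrank_le_of_nonpos hne fun x hx => ?_
      rw [hform x hx, hparity.neg_one_pow, neg_one_mul]
      exact neg_nonpos.2 (hsq _)
  have hrange : Module.finrank ℝ restrict.range ≤ (n - 1).choose (k - 1) := by
    simpa [card_kneserStar hk] using restrict.range.finrank_le
  have hrank := restrict.finrank_range_add_finrank_ker
  rw [Module.finrank_pi] at hrank
  omega

lemma choose_le_indepNum_kneserGraph (hk : 1 ≤ k) (hn : 1 ≤ n) :
    (n - 1).choose (k - 1) ≤ (kneserGraph n k).indepNum :=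
  card_kneserStar hk (⟨0, hn⟩ : Fin n) ▸ (isIndepSet_kneserStar _).card_le_indepNum

theorem indepNum_kneserGraph (hk : 1 ≤ k) (hn : 2 * k ≤ n) :
    (kneserGraph n k).indepNum = (n - 1).choose (k - 1) :=
  (indepNum_le_inertiaBound.trans (inertiaBound_kneserGraph_le hk hn)).antisymm
    (choose_le_indepNum_kneserGraph hk (by omega))

theorem inertiaBound_kneserGraph (hk : 1 ≤ k) (hn : 2 * k ≤ n) :
    (kneserGraph n k).inertiaBound = (n - 1).choose (k - 1) :=
  (inertiaBound_kneserGraph_le hk hn).antisymm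
    ((choose_le_indepNum_kneserGraph hk (by omega)).trans indepNum_le_inertiaBound)

lemma reachable_kneserGraph_of_subset_insert (hk : 1 ≤ k) (hn : 2 * k < n)
    {S T : {s : Finset (Fin n) // #s = k}} {b : Fin n} (h : T.1 ⊆ insert b S.1) :
    (kneserGraph n k).Reachable S T := by
  have hcard : k ≤ #(insert b S.1)ᶜ := by
    have hinsert := card_insert_le b S.1
    rw [S.2] at hinsert
    rw [card_compl, Fintype.card_fin]
    omega
  obtain ⟨R, hR, hRk⟩ := exists_subset_card_eq hcard
  have hdisj : Disjoint (insert b S.1) R := disjoint_compl_right.mono_right hR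
  have hSR : (kneserGraph n k).Adj S ⟨R, hRk⟩ :=
    (kneserGraph_adj_iff_disjoint hk).2 (hdisj.mono_left (subset_insert b S.1))
  have hTR : (kneserGraph n k).Adj T ⟨R, hRk⟩ :=
    (kneserGraph_adj_iff_disjoint hk).2 (hdisj.mono_left h)
  exact hSR.reachable.trans hTR.symm.reachable

theorem connected_kneserGraph (hk : 1 ≤ k) (hn : 2 * k < n) : (kneserGraph n k).Connected := by
  have := nontrivial_kneserGraph_vertex hk (by omega : k < n)
  refine ⟨fun S T => ?_⟩
  induction hm : #(S.1 \ T.1) generalizing S with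
  | zero =>
    rw [card_eq_zero, sdiff_eq_empty_iff_subset] at hm
    obtain rfl : S = T := Subtype.ext (eq_of_subset_of_card_le hm (by rw [S.2, T.2]))
    exact Reachable.rfl
  | succ m ih =>
    obtain ⟨a, ha⟩ := card_pos.1 (m.succ_pos.trans_eq hm.symm)
    obtain ⟨b, hb⟩ : (T.1 \ S.1).Nonempty := by
      rw [← card_pos, card_sdiff_comm (by rw [S.2, T.2]), hm]
      exact m.succ_pos
    have haS := (mem_sdiff.1 ha).1
    obtain ⟨hbT, hbS⟩ := mem_sdiff.1 hb
    have hcard : #(insert b (S.1.erase a)) = k := by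
      rw [card_insert_of_notMem fun h => hbS (mem_of_mem_erase h), card_erase_add_one haS, S.2]
    refine (reachable_kneserGraph_of_subset_insert hk hn (T := ⟨_, hcard⟩)
      (insert_subset_insert b (erase_subset a S.1))).trans (ih _ ?_)
    rw [insert_sdiff_of_mem _ hbT, erase_sdiff_comm, card_erase_of_mem ha, hm,
      Nat.add_sub_cancel]

end Kneser

theorem corollary3p4 (n k : ℕ) (hk : 1 ≤ k) (hn : 2 * k < n) :
    (SimpleGraph.kneserGraph n k).IsTightCvetkovicHoffman 1 ∧
    (SimpleGraph.kneserGraph n k).inertiaBound = (n - 1).choose (k - 1) ∧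
    (SimpleGraph.kneserGraph n k).ratioBound = ((n - 1).choose (k - 1) : ℝ) ∧
    (SimpleGraph.kneserGraph n k).indepNum = (n - 1).choose (k - 1) := by
  have := nontrivial_kneserGraph_vertex hk (by omega : k < n)
  have hinertia := inertiaBound_kneserGraph hk hn.le
  have hratio := ratioBound_kneserGraph hk hn.le
  have hindep := indepNum_kneserGraph hk hn.le
  exact ⟨isTightCvetkovicHoffman_one (connected_kneserGraph hk hn)
    ⟨_, isRegularOfDegree_kneserGraph hk⟩ (hinertia.trans hindep.symm) (by rw [hratio, hindep]),
    hinertia, hratio, hindep⟩
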